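/- Consider algebras $\mathbf A=\langle A,\vee,\wedge,\to,{}',0,1\rangle$ of type $(2,2,2,1,0,0)$, and write $x^*:=x\to 0$. Let $\mathbb{RUNO}1$ be the variety of regular unorthodox De Morgan semi-Heyting algebras of level 1, that is, of all such algebras for which $\langle A,\vee,\wedge,0,1\rangle$ is a lattice with least element $0$ and greatest element $1$ and which satisfy, for all $x,y,z$: * $x\wedge(x\to y)=x\wedge y$, $\;x\wedge(y\to z)=x\wedge[(x\wedge y)\to(x\wedge z)]$, $\;x\to x=1$; * $0'=1$, $\;1'=0$, $\;(x\wedge y)'=x'\vee y'$, $\;(x\vee y)''=x''\vee y''$, $\;x''=x$; * $(0\to1)'=0\to1$ (unorthodox); * $x\wedge x'{}^{*}{}'\le y\vee y^*$ (regular); * $x\wedge x'^*=(x\wedge x'^*)'^*$ (level 1). Let $\mathbf A1,\mathbf A2,\mathbf A3,\mathbf A4$ be the algebras on $\{0,1,2\}$ whose lattice reduct is the chain $0<2<1$, with $0'=1$, $1'=0$, $2'=2$ and with $$0\to0=1,\quad 0\to1=2,\quad 1\to x=x\ (x=0,1,2),\quad 2\to0=0,\quad 2\to2=1,$$ where $(0\to2,\;2\to1)$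 equals $(1,1)$ in $\mathbf A1$, $(1,2)$ in $\mathbf A2$, $(2,1)$ in $\mathbf A3$ and $(2,2)$ in $\mathbf A4$. Let $\mathbf A5$ be the algebra on $\{0,1,2,3\}$ whose lattice reduct is the four-element Boolean lattice with least element $0$, greatest element $1$, $2\vee3=1$ and $2\wedge3=0$, with $0'=1$, $1'=0$, $2'=2$, $3'=3$ and $$\begin{array}{c|cccc}\to&0&1&2&3\\\hline 0&1&2&1&2\\1&0&1&2&3\\2&3&2&1&0\\3&2&1&2&1\end{array}$$ A Boolean product of a family $(\mathbf B_x)_{x\in X}$ of algebras is a subdirect product $\mathbf B\le\prod_{x\in X}\mathbf B_x$ (a subalgebra that each coordinate projection maps onto the factor) such that $X$ can be given the topology of a Boolean space (compact, Hausdorff, totally disconnected) for which (i) $\{x\in X: f(x)=g(x)\}$ is clopen for all $f,g\in B$, and (ii) for all $f,g\in B$ and every clopen $N\subseteq X$, the element that agrees with $f$ on $N$ and with $g$ on $X\setminus N$ belongs to $B$. **Corollary.** Every $\mathbf A\in\mathbb{RUNO}1$ is isomorphic to a Boolean product of a family of algebras each of which is one of $\mathbf A1,\dots,\mathbf A5$.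 Here the index space is nonempty if $|A|>1$; for the one-element algebra it is empty. -/

import Mathlib

universe u v

namespace Runo

/-- Algebras of type `⟨∨, ∧, →, ′, 0, 1⟩` (no identities are imposed). -/
structure Alg : Type (u + 1) where
  carrier : Type u
  join : carrier → carrier → carrier
  meet : carrier → carrier → carrier
  imp : carrier → carrier → carrier
  prime : carrier → carrier
  zero : carrier
  one : carrier

namespace Alg

instance : CoeSort Alg.{u} (Type u) := ⟨Alg.carrier⟩

instance (A : Alg.{u}) : Max A.carrier := ⟨A.join⟩
instance (A : Alg.{u}) : Min A.carrier := ⟨A.meet⟩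
instance (A : Alg.{u}) : HImp A.carrier := ⟨A.imp⟩
instance (A : Alg.{u}) : Bot A.carrier := ⟨A.zero⟩
instance (A : Alg.{u}) : Top A.carrier := ⟨A.one⟩

end Alg

/-- The basic unary operation `x ↦ x′`. -/
def dm {A : Alg.{u}} (x : A) : A := A.prime x

/-- The derived unary operation `x ↦ x* := x → 0`. -/
def pc {A : Alg.{u}} (x : A) : A := x ⇨ ⊥

/-- The lattice order `x ≤ y`, as an equation. -/
def Below {A : Alg.{u}} (x y : A) : Prop := x ⊓ y = x

/-- `⟨A, ∨, ∧, 0, 1⟩` is a lattice with least element `0` and greatest element `1`. -/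
structure IsBoundedLattice (A : Alg.{u}) : Prop where
  sup_comm : ∀ x y : A, x ⊔ y = y ⊔ x
  inf_comm : ∀ x y : A, x ⊓ y = y ⊓ x
  sup_assoc : ∀ x y z : A, (x ⊔ y) ⊔ z = x ⊔ (y ⊔ z)
  inf_assoc : ∀ x y z : A, (x ⊓ y) ⊓ z = x ⊓ (y ⊓ z)
  sup_inf_self : ∀ x y : A, x ⊔ (x ⊓ y) = x
  inf_sup_self : ∀ x y : A, x ⊓ (x ⊔ y) = x
  sup_bot : ∀ x : A, x ⊔ ⊥ = x
  inf_top : ∀ x : A, x ⊓ ⊤ = x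

/-- Semi-Heyting algebras. -/
structure IsSH (A : Alg.{u}) : Prop extends IsBoundedLattice A where
  inf_himp : ∀ x y : A, x ⊓ (x ⇨ y) = x ⊓ y
  inf_himp_inf : ∀ x y z : A, x ⊓ (y ⇨ z) = x ⊓ ((x ⊓ y) ⇨ (x ⊓ z))
  himp_self : ∀ x : A, x ⇨ x = ⊤

/-- Dually hemimorphic semi-Heyting algebras. -/
structure IsDHMSH (A : Alg.{u}) : Prop extends IsSH A where
  dm_bot : dm (⊥ : A) = ⊤
  dm_top : dm (⊤ : A) = ⊥
  dm_inf : ∀ x y : A, dm (x ⊓ y) = dm x ⊔ dm y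

/-- Dually quasi-De Morgan semi-Heyting algebras. -/
structure IsDQDSH (A : Alg.{u}) : Prop extends IsDHMSH A where
  dm_dm_sup : ∀ x y : A, dm (dm (x ⊔ y)) = dm (dm x) ⊔ dm (dm y)
  dm_dm_below : ∀ x : A, Below (dm (dm x)) x

/-- De Morgan semi-Heyting algebras. -/
structure IsDMSH (A : Alg.{u}) : Prop extends IsDQDSH A where
  dm_dm : ∀ x : A, dm (dm x) = x

/-- Unorthodox De Morgan semi-Heyting algebras. -/
structure IsUNO (A : Alg.{u}) : Prop extends IsDMSH A where
  unorthodox : dm ((⊥ : A) ⇨ ⊤) = ⊥ ⇨ ⊤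

/-- Regular unorthodox De Morgan semi-Heyting algebras. -/
structure IsRUNO (A : Alg.{u}) : Prop extends IsUNO A where
  regular : ∀ x y : A, Below (x ⊓ dm (pc (dm x))) (y ⊔ pc y)

/-- Regular unorthodox De Morgan semi-Heyting algebras of level 1. -/
structure IsRUNO1 (A : Alg.{u}) : Prop extends IsRUNO A where
  level_one : ∀ x : A, x ⊓ pc (dm x) = pc (dm (x ⊓ pc (dm x)))

/-- The variety `RUNO1`, as a class of algebras. -/
def RUNO1 : Set Alg.{u} := {A | IsRUNO1 A}

/-- The algebra on `{0, 1, 2}` whose lattice reduct is the chain `0 < 2 < 1`, whose unary operation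
is `0′ = 1`, `1′ = 0`, `2′ = 2`, and whose implication has the given table (rows: first argument;
rows and columns in the order `0, 1, 2`). -/
def chainAlg (t : Fin 3 → Fin 3 → Fin 3) : Alg.{0} where
  carrier := Fin 3
  join x y := ![![0, 1, 2],
                ![1, 1, 1],
                ![2, 1, 2]] x y
  meet x y := ![![0, 0, 0],
                ![0, 1, 2],
                ![0, 2, 2]] x y
  imp := t
  prime x := ![1, 0, 2] x
  zero := 0
  one := 1

def A1 : Alg.{0} := chainAlg fun x y => ![![1, 2, 1],
                                          ![0, 1, 2],
                                          ![0, 1, 1]] x y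

def A2 : Alg.{0} := chainAlg fun x y => ![![1, 2, 1],
                                          ![0, 1, 2],
                                          ![0, 2, 1]] x y

def A3 : Alg.{0} := chainAlg fun x y => ![![1, 2, 2],
                                          ![0, 1, 2],
                                          ![0, 1, 1]] x y

def A4 : Alg.{0} := chainAlg fun x y => ![![1, 2, 2],
                                          ![0, 1, 2],
                                          ![0, 2, 1]] x y

/-- The lattice reduct is the four-element Boolean lattice with `2 ∨ 3 = 1` and `2 ∧ 3 = 0`. -/
def A5 : Alg.{0} where
  carrier := Fin 4
  join x y := ![![0, 1, 2, 3],
                ![1, 1, 1, 1],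
                ![2, 1, 2, 1],
                ![3, 1, 1, 3]] x y
  meet x y := ![![0, 0, 0, 0],
                ![0, 1, 2, 3],
                ![0, 2, 2, 0],
                ![0, 3, 0, 3]] x y
  imp x y := ![![1, 2, 1, 2],
               ![0, 1, 2, 3],
               ![3, 2, 1, 0],
               ![2, 1, 2, 1]] x y
  prime x := ![1, 0, 2, 3] x
  zero := 0
  one := 1

/-- Isomorphisms of algebras. -/
structure Iso (A : Alg.{u}) (B : Alg.{v}) extends A.carrier ≃ B.carrier where
  map_sup : ∀ x y : A, toFun (x ⊔ y) = toFun x ⊔ toFun y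
  map_inf : ∀ x y : A, toFun (x ⊓ y) = toFun x ⊓ toFun y
  map_himp : ∀ x y : A, toFun (x ⇨ y) = toFun x ⇨ toFun y
  map_dm : ∀ x : A, toFun (dm x) = dm (toFun x)
  map_bot : toFun (⊥ : A) = ⊥
  map_top : toFun (⊤ : A) = ⊤

/-- Direct products of algebras, with componentwise operations. -/
def prod {X : Type u} (F : X → Alg.{v}) : Alg.{max u v} where
  carrier := ∀ x, F x
  join f g x := f x ⊔ g x
  meet f g x := f x ⊓ g x
  imp f g x := f x ⇨ g x
  prime f x := dm (f x)
  zero _ := ⊥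
  one _ := ⊤

/-- Subalgebras. -/
structure SubAlg (A : Alg.{u}) where
  carrier : Set A.carrier
  sup_mem : ∀ x ∈ carrier, ∀ y ∈ carrier, x ⊔ y ∈ carrier
  inf_mem : ∀ x ∈ carrier, ∀ y ∈ carrier, x ⊓ y ∈ carrier
  himp_mem : ∀ x ∈ carrier, ∀ y ∈ carrier, x ⇨ y ∈ carrier
  dm_mem : ∀ x ∈ carrier, dm x ∈ carrier
  bot_mem : ⊥ ∈ carrier
  top_mem : ⊤ ∈ carrier

/-- A subalgebra as an algebra in its own right. -/
def SubAlg.toAlg {A : Alg.{u}} (S : SubAlg A) : Alg.{u} where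
  carrier := {x : A.carrier // x ∈ S.carrier}
  join x y := ⟨x.1 ⊔ y.1, S.sup_mem _ x.2 _ y.2⟩
  meet x y := ⟨x.1 ⊓ y.1, S.inf_mem _ x.2 _ y.2⟩
  imp x y := ⟨x.1 ⇨ y.1, S.himp_mem _ x.2 _ y.2⟩
  prime x := ⟨dm x.1, S.dm_mem _ x.2⟩
  zero := ⟨⊥, S.bot_mem⟩
  one := ⟨⊤, S.top_mem⟩

/-- The subalgebra `S` of the direct product of `(F x)`, `x ∈ X`, is a Boolean product of this
family with respect to the given topology of `X`. The index space may be empty (this is the case of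
the one-element algebra). -/
structure IsBooleanProduct {X : Type u} [TopologicalSpace X] (F : X → Alg.{v})
    (S : SubAlg (prod F)) : Prop where
  /-- `X` is a Boolean space: compact, Hausdorff and totally disconnected. -/
  compact : CompactSpace X
  hausdorff : T2Space X
  totallyDisconnected : TotallyDisconnectedSpace X
  /-- `S` is a subdirect product: all the coordinate projections are onto. -/
  subdirect : ∀ (x : X) (c : F x), ∃ f ∈ S.carrier, f x = c
  /-- Equalizers are clopen. -/
  equalizer_clopen : ∀ f ∈ S.carrier, ∀ g ∈ S.carrier, IsClopen {x : X | f x = g x}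
  /-- Patchwork property: `f` on a clopen `N` glued with `g` off `N` is in `S`. -/
  patchwork : ∀ f ∈ S.carrier, ∀ g ∈ S.carrier, ∀ N : Set X, IsClopen N →
    ∀ h : (prod F).carrier, (∀ x ∈ N, h x = f x) → (∀ x ∉ N, h x = g x) → h ∈ S.carrier

end Runo

set_option linter.unusedSectionVars false

/-! The elements `b` with `b ⊓ dm b = ⊥` form a Boolean algebra with complement `dm`. By the level 1
identity, `nec x = x ⊓ pc (dm x)` is the largest such element below `x`. Hence `nec (biimp x y)` is
the largest central element below which `x` and `y` agree. An ultrafilter of central elements gives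
a congruence: agreement below some member. Equalizers of germs are then the basic clopen sets of the
Stone space, the ultrafilters separate points, and central elements glue. This is a Boolean product
with the stalks as factors.

It remains to identify the stalks. In a stalk, `nec x = ⊥` for `x ≠ ⊤` (`nec_eq_bot_of_ne_top`).
With regularity this makes `dm` fix everything except `⊥` and `⊤` (`IsLocal.dm_eq_self'`), so these
elements form an antichain. The unorthodox identity supplies one of them, `a = ⊥ ⇨ ⊤`, and the only
other candidate is `pc a`. If `pc a = ⊥` the stalk is a three-element chain with two undetermined
values of `⇨`, giving `A1` to `A4`; otherwise it is `A5`. -/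

namespace Runo

/-! ### Lattice structure, central elements and equality degrees -/

section Lattice

variable {A : Alg.{u}} [hA : Fact (IsRUNO1 A)]

instance : Lattice A.carrier :=
  Lattice.mk' hA.out.sup_comm hA.out.sup_assoc hA.out.inf_comm hA.out.inf_assoc
    hA.out.sup_inf_self hA.out.inf_sup_self

instance : BoundedOrder A.carrier where
  le_top x := inf_eq_left.1 (hA.out.inf_top x)
  bot_le x := sup_eq_left.1 (hA.out.sup_bot x)

theorem himp_self' (x : A) : x ⇨ x = ⊤ := hA.out.himp_self x

theorem inf_himp' (x y : A) : x ⊓ (x ⇨ y) = x ⊓ y := hA.out.inf_himp x y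

theorem inf_himp_inf' (x y z : A) : x ⊓ (y ⇨ z) = x ⊓ ((x ⊓ y) ⇨ (x ⊓ z)) :=
  hA.out.inf_himp_inf x y z

/-- The term `x → (x ∧ w)` is the relative pseudocomplement. -/
theorem le_himp_inf_iff {x y w : A} : y ≤ x ⇨ (x ⊓ w) ↔ x ⊓ y ≤ w := by
  constructor
  · intro h
    calc x ⊓ y ≤ x ⊓ (x ⇨ (x ⊓ w)) := inf_le_inf_left x h
      _ = x ⊓ (x ⊓ w) := inf_himp' _ _
      _ ≤ w := inf_le_right.trans inf_le_right
  · intro h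
    have h1 : y ⊓ (x ⊓ w) = y ⊓ x := by
      rw [← inf_assoc, inf_eq_left, inf_comm]; exact h
    rw [← inf_eq_left, inf_himp_inf' y x, h1, himp_self', inf_top_eq]

/-- Meeting with a fixed element has a right adjoint by `le_himp_inf_iff`, so it preserves joins. -/
instance : DistribLattice A.carrier :=
  DistribLattice.ofInfSupLe fun _ _ _ =>
    le_himp_inf_iff.1 (sup_le (le_himp_inf_iff.2 le_sup_left) (le_himp_inf_iff.2 le_sup_right))

theorem le_pc_iff {x y : A} : y ≤ pc x ↔ x ⊓ y = ⊥ := by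
  have := le_himp_inf_iff (x := x) (y := y) (w := ⊥)
  rwa [inf_bot_eq, le_bot_iff] at this

theorem inf_pc (x : A) : x ⊓ pc x = ⊥ := le_pc_iff.1 le_rfl

theorem pc_anti {x y : A} (h : x ≤ y) : pc y ≤ pc x :=
  le_pc_iff.2 (le_bot_iff.1 ((inf_le_inf_right _ h).trans (inf_pc y).le))

theorem le_pc_pc (x : A) : x ≤ pc (pc x) := le_pc_iff.2 (by rw [inf_comm, inf_pc])

theorem pc_top : pc (⊤ : A) = ⊥ := by simpa using inf_pc (⊤ : A)

theorem top_himp' (x : A) : ⊤ ⇨ x = x := by simpa using inf_himp' ⊤ x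

theorem dm_dm' (x : A) : dm (dm x) = x := hA.out.dm_dm x

theorem dm_bot' : dm (⊥ : A) = ⊤ := hA.out.dm_bot

theorem dm_top' : dm (⊤ : A) = ⊥ := hA.out.dm_top

theorem dm_inf' (x y : A) : dm (x ⊓ y) = dm x ⊔ dm y := hA.out.dm_inf x y

theorem dm_sup' (x y : A) : dm (x ⊔ y) = dm x ⊓ dm y := by
  rw [← dm_dm' (dm x ⊓ dm y), dm_inf', dm_dm', dm_dm']

theorem dm_anti {x y : A} (h : x ≤ y) : dm y ≤ dm x := by
  rw [← sup_eq_left, ← dm_inf', inf_eq_left.2 h]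

theorem dm_le_of_dm_le {x y : A} (h : dm x ≤ y) : dm y ≤ x := by
  simpa only [dm_dm'] using dm_anti h

theorem dm_eq_bot {x : A} : dm x = ⊥ ↔ x = ⊤ :=
  ⟨fun h => by rw [← dm_dm' x, h, dm_bot'], fun h => by rw [h, dm_top']⟩

theorem dm_eq_top {x : A} : dm x = ⊤ ↔ x = ⊥ :=
  ⟨fun h => by rw [← dm_dm' x, h, dm_top'], fun h => by rw [h, dm_bot']⟩

/-- The elements for which the De Morgan negation is a complement. -/
def IsCentral (b : A) : Prop := b ⊓ dm b = ⊥

theorem IsCentral.sup_dm {b : A} (hb : IsCentral b) : b ⊔ dm b = ⊤ := by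
  rw [← dm_eq_bot, dm_sup', dm_dm', inf_comm]; exact hb

theorem IsCentral.dm {b : A} (hb : IsCentral b) : IsCentral (dm b) := by
  unfold IsCentral; rw [dm_dm', inf_comm]; exact hb

theorem IsCentral.inf {b c : A} (hb : IsCentral b) (hc : IsCentral c) : IsCentral (b ⊓ c) := by
  unfold IsCentral at *
  rw [dm_inf', inf_sup_left, inf_right_comm, hb, inf_assoc, hc]; simp

theorem IsCentral.sup {b c : A} (hb : IsCentral b) (hc : IsCentral c) : IsCentral (b ⊔ c) := by
  have := (hb.dm.inf hc.dm).dm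
  rwa [dm_inf', dm_dm', dm_dm'] at this

theorem isCentral_bot : IsCentral (⊥ : A) := bot_inf_eq _

/-- The largest central element below `x`. -/
def nec (x : A) : A := x ⊓ pc (dm x)

theorem nec_le (x : A) : nec x ≤ x := inf_le_left

/-- Level 1 says that `nec x` equals `pc (dm (nec x))`, which is disjoint from `dm (nec x)`. -/
theorem isCentral_nec (x : A) : IsCentral (nec x) := by
  have h : nec x = pc (dm (nec x)) := hA.out.level_one x
  have h' := inf_pc (dm (nec x))
  rwa [← h, inf_comm] at h'

theorem IsCentral.le_nec {b x : A} (hb : IsCentral b) (h : b ≤ x) : b ≤ nec x :=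
  le_inf h (le_pc_iff.2 (le_bot_iff.1 (by
    rw [inf_comm, ← show b ⊓ Runo.dm b = ⊥ from hb]; exact inf_le_inf_left _ (dm_anti h))))

/-- The equality degree of two elements. -/
def biimp (x y : A) : A := (x ⇨ y) ⊓ (y ⇨ x)

theorem le_himp_of_inf_eq {b x y : A} (h : b ⊓ x = b ⊓ y) : b ≤ x ⇨ y := by
  rw [← inf_eq_left, inf_himp_inf' b, h, himp_self', inf_top_eq]

theorem inf_le_of_le_himp {b x y : A} (h : b ≤ x ⇨ y) : b ⊓ x ≤ y :=
  calc b ⊓ x ≤ (x ⇨ y) ⊓ x := inf_le_inf_right _ h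
    _ = x ⊓ y := by rw [inf_comm, inf_himp']
    _ ≤ y := inf_le_right

/-- In a semi-Heyting algebra `⇨` need not be residuated, but the symmetrized implication still
measures equality. -/
theorem le_biimp_iff {b x y : A} : b ≤ biimp x y ↔ b ⊓ x = b ⊓ y := by
  constructor
  · intro h
    exact le_antisymm (le_inf inf_le_left (inf_le_of_le_himp (h.trans inf_le_left)))
      (le_inf inf_le_left (inf_le_of_le_himp (h.trans inf_le_right)))
  · intro h
    exact le_inf (le_himp_of_inf_eq h) (le_himp_of_inf_eq h.symm)

theorem IsCentral.le_nec_biimp_iff {b x y : A} (hb : IsCentral b) :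
    b ≤ nec (biimp x y) ↔ b ⊓ x = b ⊓ y :=
  ⟨fun h => le_biimp_iff.1 (h.trans (nec_le _)), fun h => hb.le_nec (le_biimp_iff.2 h)⟩

theorem nec_biimp_inf (x y : A) : nec (biimp x y) ⊓ x = nec (biimp x y) ⊓ y :=
  (isCentral_nec _).le_nec_biimp_iff.1 le_rfl

end Lattice

/-! ### The Stone space of the central elements -/

section Points

variable {A : Alg.{u}} [hA : Fact (IsRUNO1 A)]

/-- Indicator functions of the ultrafilters of the Boolean algebra of central elements. -/
structure IsPoint (p : A → Bool) : Prop where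
  isCentral : ∀ x, p x = true → IsCentral x
  map_inf : ∀ b c, IsCentral b → IsCentral c → p (b ⊓ c) = (p b && p c)
  map_dm : ∀ b, IsCentral b → p (dm b) = !p b

variable (A) in
/-- The Stone space of the Boolean algebra of central elements. -/
def Point : Type u := {p : A → Bool // IsPoint p}

instance : TopologicalSpace (Point A) :=
  inferInstanceAs (TopologicalSpace {p : A → Bool // IsPoint p})

instance : T2Space (Point A) := inferInstanceAs (T2Space {p : A → Bool // IsPoint p})

instance : TotallyDisconnectedSpace (Point A) :=
  inferInstanceAs (TotallyDisconnectedSpace {p : A → Bool // IsPoint p})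

/-- Each condition involves finitely many coordinates, so it is closed in the Cantor space `A →
Bool`; compactness of `Point A` follows. -/
theorem isClosed_isPoint : IsClosed {p : A → Bool | IsPoint p} := by
  have : {p : A → Bool | IsPoint p} =
      (⋂ x : A, {p | p x = true → IsCentral x}) ∩
      (⋂ (b : A) (c : A), {p | IsCentral b → IsCentral c → p (b ⊓ c) = (p b && p c)}) ∩
      (⋂ b : A, {p | IsCentral b → p (dm b) = !p b}) := by
    ext p
    simp only [Set.mem_ofPred_eq, Set.mem_inter_iff, Set.mem_iInter]
    exact ⟨fun h => ⟨⟨h.1, h.2⟩, h.3⟩, fun h => ⟨h.1.1, h.1.2, h.2⟩⟩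
  rw [this]
  refine ((isClosed_iInter fun x => ?_).inter
    (isClosed_iInter fun b => isClosed_iInter fun c => ?_)).inter (isClosed_iInter fun b => ?_)
  · exact (isClosed_discrete {t : Bool | t = true → IsCentral x}).preimage
      (f := fun p : A → Bool => p x) (by fun_prop)
  · exact (isClosed_discrete {t : Bool × Bool × Bool |
      IsCentral b → IsCentral c → t.1 = (t.2.1 && t.2.2)}).preimage
      (f := fun p : A → Bool => (p (b ⊓ c), p b, p c)) (by fun_prop)
  · exact (isClosed_discrete {t : Bool × Bool | IsCentral b → t.1 = !t.2}).preimage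
      (f := fun p : A → Bool => (p (dm b), p b)) (by fun_prop)

instance : CompactSpace (Point A) := isCompact_iff_compactSpace.1 isClosed_isPoint.isCompact

/-- The basic clopen set of all ultrafilters that contain `b`. -/
def basic (b : A) : Set (Point A) := {p | p.1 b = true}

theorem isClopen_basic (b : A) : IsClopen (basic b) :=
  (isClopen_discrete {true}).preimage
    ((continuous_apply b).comp continuous_subtype_val : Continuous fun p : Point A => p.1 b)

theorem basic_inf {b c : A} (hb : IsCentral b) (hc : IsCentral c) :
    basic (b ⊓ c) = basic b ∩ basic c := by
  ext p
  simp [basic, p.2.map_inf b c hb hc]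

theorem basic_dm {b : A} (hb : IsCentral b) : basic (dm b) = (basic b)ᶜ := by
  ext p
  simp [basic, p.2.map_dm b hb]

theorem basic_sup {b c : A} (hb : IsCentral b) (hc : IsCentral c) :
    basic (b ⊔ c) = basic b ∪ basic c := by
  rw [← dm_dm' (b ⊔ c), dm_sup', basic_dm (hb.dm.inf hc.dm), basic_inf hb.dm hc.dm, basic_dm hb,
    basic_dm hc, Set.compl_inter, compl_compl, compl_compl]

theorem basic_bot : basic (⊥ : A) = ∅ := by
  have h := basic_inf (isCentral_bot (A := A)) isCentral_bot.dm
  rwa [basic_dm isCentral_bot, Set.inter_compl_self, bot_inf_eq] at h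

theorem basic_mono {b c : A} (hb : IsCentral b) (hc : IsCentral c) (h : b ≤ c) :
    basic b ⊆ basic c := by
  rw [← inf_eq_left.2 h, basic_inf hb hc]; exact Set.inter_subset_right

theorem basic_nonempty {b : A} (hb : b ≠ ⊥) (hc : IsCentral b) : (basic b).Nonempty := by
  classical
  -- The prime ideal is taken in the whole distributive lattice `A`; the central elements outside it
  -- form the ultrafilter.
  obtain ⟨J, hJ, -, hd⟩ := DistribLattice.prime_ideal_of_disjoint_filter_ideal
    (F := Order.PFilter.principal b) (I := Order.Ideal.principal (⊥ : A)) (by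
      rw [Set.disjoint_left]
      intro x hx hx'
      have h1 : b ≤ x := hx
      have h2 : x = ⊥ := le_bot_iff.1 hx'
      exact hb (le_bot_iff.1 (h2 ▸ h1)))
  have hbJ : b ∉ J := fun h => Set.disjoint_left.1 hd (show b ≤ b from le_rfl) h
  refine ⟨⟨fun x => decide (IsCentral x ∧ x ∉ J), ⟨fun x hx => (of_decide_eq_true hx).1, ?_, ?_⟩⟩, ?_⟩
  · intro x y hx hy
    rw [Bool.eq_iff_iff]
    simp only [decide_eq_true_eq, Bool.and_eq_true, hx, hy, hx.inf hy, true_and]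
    constructor
    · intro h
      exact ⟨fun h' => h (J.lower inf_le_left h'), fun h' => h (J.lower inf_le_right h')⟩
    · rintro ⟨h1, h2⟩ h
      exact (hJ.mem_or_mem h).elim h1 h2
  · intro x hx
    rw [Bool.eq_iff_iff]
    simp only [decide_eq_true_eq, Bool.not_eq_true', decide_eq_false_iff_not, hx, hx.dm, true_and,
      not_not]
    constructor
    · intro h
      refine (hJ.mem_or_mem (x := x) (y := dm x) ?_).resolve_right h
      rw [show x ⊓ dm x = ⊥ from hx]; exact J.bot_mem
    · intro h h'
      apply hbJ
      refine J.lower ?_ (J.sup_mem h h')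
      rw [hx.sup_dm]; exact le_top
  · exact decide_eq_true ⟨hc, hbJ⟩

theorem exists_mem_basic_notMem {p q : Point A} (h : p ≠ q) :
    ∃ b, IsCentral b ∧ p ∈ basic b ∧ q ∉ basic b := by
  obtain ⟨x, hx⟩ : ∃ x, p.1 x ≠ q.1 x := by
    by_contra! hc
    exact h (Subtype.ext (funext hc))
  by_cases hp : p.1 x = true
  · exact ⟨x, p.2.isCentral x hp, hp, fun hq => hx (hp.trans (Eq.symm hq))⟩
  · have hq : q.1 x = true := by
      cases hqx : q.1 x <;> simp_all
    have hxc := q.2.isCentral x hq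
    refine ⟨dm x, hxc.dm, ?_, ?_⟩ <;> rw [basic_dm hxc]
    · exact hp
    · exact fun h' => h' hq

theorem exists_eq_basic {N : Set (Point A)} (hN : IsClopen N) :
    ∃ b : A, IsCentral b ∧ N = basic b := by
  have key : ∀ p ∈ N, ∃ b, IsCentral b ∧ p ∈ basic b ∧ basic b ⊆ N := by
    intro p hp
    -- Compactness of the complement: finitely many separating basic sets are intersected.
    have : ∃ b, IsCentral b ∧ p ∈ basic b ∧ Disjoint (basic b) Nᶜ := by
      refine hN.compl.isClosed.isCompact.induction_on
        (p := fun s => ∃ b, IsCentral b ∧ p ∈ basic b ∧ Disjoint (basic b) s) ?_ ?_ ?_ ?_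
      · refine ⟨dm ⊥, isCentral_bot.dm, ?_, Set.disjoint_empty _⟩
        rw [basic_dm isCentral_bot, basic_bot]; simp
      · rintro s t hst ⟨b, hb, hpb, hd⟩
        exact ⟨b, hb, hpb, hd.mono_right hst⟩
      · rintro s t ⟨b, hb, hpb, hd⟩ ⟨c, hc, hpc, hd'⟩
        refine ⟨b ⊓ c, hb.inf hc, ?_, ?_⟩ <;> rw [basic_inf hb hc]
        · exact ⟨hpb, hpc⟩
        · exact Set.disjoint_union_right.2
            ⟨hd.mono_left Set.inter_subset_left, hd'.mono_left Set.inter_subset_right⟩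
      · intro q hq
        obtain ⟨b, hb, hpb, hqb⟩ := exists_mem_basic_notMem (p := p) (q := q)
          (fun h => hq (h ▸ hp))
        exact ⟨(basic b)ᶜ, mem_nhdsWithin_of_mem_nhds
          ((isClopen_basic b).compl.isOpen.mem_nhds hqb), b, hb, hpb, disjoint_compl_right⟩
    obtain ⟨b, hb, hpb, hd⟩ := this
    exact ⟨b, hb, hpb, Set.disjoint_compl_right_iff_subset.1 hd⟩
  -- Compactness of `N`: finitely many basic sets inside `N` cover it, and their union is basic.
  have : ∃ b, IsCentral b ∧ N ⊆ basic b ∧ basic b ⊆ N := by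
    refine hN.isClosed.isCompact.induction_on
      (p := fun s => ∃ b, IsCentral b ∧ s ⊆ basic b ∧ basic b ⊆ N) ?_ ?_ ?_ ?_
    · exact ⟨⊥, isCentral_bot, Set.empty_subset _, by rw [basic_bot]; exact Set.empty_subset _⟩
    · rintro s t hst ⟨b, hb, h1, h2⟩
      exact ⟨b, hb, hst.trans h1, h2⟩
    · rintro s t ⟨b, hb, h1, h2⟩ ⟨c, hc, h3, h4⟩
      refine ⟨b ⊔ c, hb.sup hc, ?_, ?_⟩ <;> rw [basic_sup hb hc]
      · exact Set.union_subset_union h1 h3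
      · exact Set.union_subset h2 h4
    · intro p hp
      obtain ⟨b, hb, hpb, hbN⟩ := key p hp
      exact ⟨basic b, mem_nhdsWithin_of_mem_nhds ((isClopen_basic b).isOpen.mem_nhds hpb),
        b, hb, subset_rfl, hbN⟩
  obtain ⟨b, hb, h1, h2⟩ := this
  exact ⟨b, hb, h1.antisymm h2⟩

end Points

/-- Homomorphisms of algebras. -/
structure IsHom {A : Alg.{u}} {B : Alg.{v}} (f : A → B) : Prop where
  map_sup : ∀ x y : A, f (x ⊔ y) = f x ⊔ f y
  map_inf : ∀ x y : A, f (x ⊓ y) = f x ⊓ f y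
  map_himp : ∀ x y : A, f (x ⇨ y) = f x ⇨ f y
  map_dm : ∀ x : A, f (dm x) = dm (f x)
  map_bot : f (⊥ : A) = ⊥
  map_top : f (⊤ : A) = ⊤

theorem IsHom.map_pc {A : Alg.{u}} {B : Alg.{v}} {f : A → B} (hf : IsHom f) (x : A) :
    f (pc x) = pc (f x) := by
  unfold pc; rw [hf.map_himp, hf.map_bot]

theorem IsHom.comp {A B C : Alg} {g : B → C} {f : A → B} (hg : IsHom g) (hf : IsHom f) :
    IsHom fun x => g (f x) where
  map_sup x y := by rw [hf.map_sup, hg.map_sup]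
  map_inf x y := by rw [hf.map_inf, hg.map_inf]
  map_himp x y := by rw [hf.map_himp, hg.map_himp]
  map_dm x := by rw [hf.map_dm, hg.map_dm]
  map_bot := by rw [hf.map_bot, hg.map_bot]
  map_top := by rw [hf.map_top, hg.map_top]

theorem IsHom.symm {A : Alg.{u}} {B : Alg.{v}} (e : A.carrier ≃ B.carrier) (he : IsHom e) :
    IsHom e.symm where
  map_sup x y := e.injective (by simp [he.map_sup])
  map_inf x y := e.injective (by simp [he.map_inf])
  map_himp x y := e.injective (by simp [he.map_himp])
  map_dm x := e.injective (by simp [he.map_dm])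
  map_bot := e.injective (by simp [he.map_bot])
  map_top := e.injective (by simp [he.map_top])

/-- Identities pass to homomorphic images; this puts the stalks in the variety. -/
theorem IsRUNO1.of_surjective {A : Alg.{u}} {B : Alg.{v}} {f : A → B} (hA : IsRUNO1 A)
    (hf : IsHom f) (hs : Function.Surjective f) : IsRUNO1 B where
  sup_comm := hs.forall₂.2 fun x y => by simp only [← hf.map_sup, hA.sup_comm x y]
  inf_comm := hs.forall₂.2 fun x y => by simp only [← hf.map_inf, hA.inf_comm x y]
  sup_assoc := hs.forall₃.2 fun x y z => by simp only [← hf.map_sup, hA.sup_assoc]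
  inf_assoc := hs.forall₃.2 fun x y z => by simp only [← hf.map_inf, hA.inf_assoc]
  sup_inf_self := hs.forall₂.2 fun x y => by
    simp only [← hf.map_sup, ← hf.map_inf, hA.sup_inf_self]
  inf_sup_self := hs.forall₂.2 fun x y => by
    simp only [← hf.map_sup, ← hf.map_inf, hA.inf_sup_self]
  sup_bot := hs.forall.2 fun x => by simp only [← hf.map_sup, ← hf.map_bot, hA.sup_bot]
  inf_top := hs.forall.2 fun x => by simp only [← hf.map_inf, ← hf.map_top, hA.inf_top]
  inf_himp := hs.forall₂.2 fun x y => by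
    simp only [← hf.map_inf, ← hf.map_himp, hA.inf_himp]
  inf_himp_inf := hs.forall₃.2 fun x y z => by
    simp only [← hf.map_inf, ← hf.map_himp, ← hA.inf_himp_inf]
  himp_self := hs.forall.2 fun x => by simp only [← hf.map_himp, ← hf.map_top, hA.himp_self]
  dm_bot := by simp only [← hf.map_dm, ← hf.map_bot, ← hf.map_top, hA.dm_bot]
  dm_top := by simp only [← hf.map_dm, ← hf.map_bot, ← hf.map_top, hA.dm_top]
  dm_inf := hs.forall₂.2 fun x y => by
    simp only [← hf.map_inf, ← hf.map_sup, ← hf.map_dm, hA.dm_inf]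
  dm_dm_sup := hs.forall₂.2 fun x y => by
    simp only [← hf.map_sup, ← hf.map_dm, hA.dm_dm_sup]
  dm_dm_below := hs.forall.2 fun x => by
    have := hA.dm_dm_below x
    unfold Below at *
    simp only [← hf.map_inf, ← hf.map_dm, this]
  dm_dm := hs.forall.2 fun x => by simp only [← hf.map_dm, hA.dm_dm]
  unorthodox := by
    simp only [← hf.map_dm, ← hf.map_bot, ← hf.map_top, ← hf.map_himp, hA.unorthodox]
  regular := hs.forall₂.2 fun x y => by
    have := hA.regular x y
    unfold Below at *
    simp only [← hf.map_inf, ← hf.map_sup, ← hf.map_dm, ← hf.map_pc, this]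
  level_one := hs.forall.2 fun x => by
    simp only [← hf.map_inf, ← hf.map_dm, ← hf.map_pc, ← hA.level_one]

/-! ### Stalks at ultrafilters of central elements -/

section Stalk

variable {A : Alg.{u}} [hA : Fact (IsRUNO1 A)] {p : Point A}

theorem mem_basic_nec_biimp_iff {x y : A} :
    p ∈ basic (nec (biimp x y)) ↔ ∃ b, p ∈ basic b ∧ b ⊓ x = b ⊓ y := by
  constructor
  · exact fun h => ⟨_, h, nec_biimp_inf x y⟩
  · rintro ⟨b, hb, h⟩
    have hc := p.2.isCentral b hb
    exact basic_mono hc (isCentral_nec _) (hc.le_nec_biimp_iff.2 h) hb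

theorem inf_mem_basic {b c : A} (hb : p ∈ basic b) (hc : p ∈ basic c) : p ∈ basic (b ⊓ c) := by
  rw [basic_inf (p.2.isCentral b hb) (p.2.isCentral c hc)]
  exact ⟨hb, hc⟩

theorem top_mem_basic : p ∈ basic (⊤ : A) := by
  rw [← dm_bot', basic_dm isCentral_bot, basic_bot]; simp

theorem inf_eq_of_le {b c x y : A} (h : b ≤ c) (hc : c ⊓ x = c ⊓ y) : b ⊓ x = b ⊓ y := by
  rw [← inf_eq_left.2 h, inf_assoc, hc, inf_assoc]

variable (p) in
/-- The congruence of `A` that belongs to an ultrafilter of central elements. -/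
def stalkSetoid : Setoid A.carrier where
  r x y := p ∈ basic (nec (biimp x y))
  iseqv := by
    simp only [mem_basic_nec_biimp_iff]
    refine ⟨fun x => ⟨⊤, top_mem_basic, rfl⟩, fun ⟨b, hb, h⟩ => ⟨b, hb, h.symm⟩, ?_⟩
    rintro x y z ⟨b, hb, h⟩ ⟨c, hc, h'⟩
    exact ⟨b ⊓ c, inf_mem_basic hb hc,
      (inf_eq_of_le inf_le_left h).trans (inf_eq_of_le inf_le_right h')⟩

theorem stalkSetoid_iff {x y : A} :
    (stalkSetoid p).r x y ↔ ∃ b, p ∈ basic b ∧ b ⊓ x = b ⊓ y := mem_basic_nec_biimp_iff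

theorem stalkSetoid_map₂ {m : A → A → A}
    (hm : ∀ b x y x' y' : A, b ⊓ x = b ⊓ x' → b ⊓ y = b ⊓ y' → b ⊓ m x y = b ⊓ m x' y')
    ⦃x x' : A⦄ (hx : (stalkSetoid p).r x x') ⦃y y' : A⦄ (hy : (stalkSetoid p).r y y') :
    (stalkSetoid p).r (m x y) (m x' y') := by
  rw [stalkSetoid_iff] at *
  obtain ⟨b, hb, h⟩ := hx
  obtain ⟨c, hc, h'⟩ := hy
  exact ⟨b ⊓ c, inf_mem_basic hb hc, hm _ _ _ _ _ (inf_eq_of_le inf_le_left h)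
    (inf_eq_of_le inf_le_right h')⟩

/-- Agreement below any `b` is respected by `⊔`, `⊓` and `⇨`; for `dm` centrality of `b` is needed.
-/
theorem IsCentral.inf_dm_inf {b : A} (hb : IsCentral b) (x : A) :
    b ⊓ Runo.dm (b ⊓ x) = b ⊓ Runo.dm x := by
  rw [dm_inf', inf_sup_left, show b ⊓ Runo.dm b = ⊥ from hb, bot_sup_eq]

variable (p) in
/-- The quotient of `A` by the congruence that belongs to an ultrafilter of central elements. -/
def stalk : Alg.{u} where
  carrier := Quotient (stalkSetoid p)
  join := Quotient.map₂ (· ⊔ ·) (stalkSetoid_map₂ fun b x y x' y' h h' => by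
    rw [inf_sup_left, h, h', ← inf_sup_left])
  meet := Quotient.map₂ (· ⊓ ·) (stalkSetoid_map₂ fun b x y x' y' h h' => by
    rw [inf_inf_distrib_left, h, h', ← inf_inf_distrib_left])
  imp := Quotient.map₂ (· ⇨ ·) (stalkSetoid_map₂ fun b x y x' y' h h' => by
    rw [inf_himp_inf', h, h', ← inf_himp_inf'])
  prime := Quotient.map dm fun x y h => by
    change (stalkSetoid p).r x y at h
    change (stalkSetoid p).r _ _
    rw [stalkSetoid_iff] at *
    obtain ⟨b, hb, h⟩ := h
    have hc := p.2.isCentral b hb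
    exact ⟨b, hb, by rw [← hc.inf_dm_inf, h, hc.inf_dm_inf]⟩
  zero := Quotient.mk _ ⊥
  one := Quotient.mk _ ⊤

variable (p) in
/-- The canonical projection onto a stalk. -/
def germ (x : A) : stalk p := Quotient.mk (stalkSetoid p) x

theorem germ_surjective : Function.Surjective (germ p) := Quotient.exists_rep

theorem isHom_germ : IsHom (germ p) where
  map_sup _ _ := rfl
  map_inf _ _ := rfl
  map_himp _ _ := rfl
  map_dm _ := rfl
  map_bot := rfl
  map_top := rfl

theorem germ_eq_iff {x y : A} : germ p x = germ p y ↔ p ∈ basic (nec (biimp x y)) :=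
  Quotient.eq (r := stalkSetoid p)

theorem germ_eq_iff_exists {x y : A} :
    germ p x = germ p y ↔ ∃ b, p ∈ basic b ∧ b ⊓ x = b ⊓ y :=
  germ_eq_iff.trans mem_basic_nec_biimp_iff

instance : Fact (IsRUNO1 (stalk p)) := ⟨hA.out.of_surjective isHom_germ germ_surjective⟩

theorem stalk_bot_ne_top : (⊥ : stalk p) ≠ ⊤ := by
  intro h
  obtain ⟨b, hb, h'⟩ := germ_eq_iff_exists.1 (show germ p ⊥ = germ p ⊤ from h)
  rw [inf_bot_eq, inf_top_eq] at h'
  rw [← h', basic_bot] at hb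
  exact hb

theorem nec_eq_bot_of_ne_top (x : stalk p) (hx : x ≠ ⊤) : nec x = ⊥ := by
  obtain ⟨x, rfl⟩ := germ_surjective x
  have hc := isCentral_nec x
  change germ p (nec x) = germ p ⊥
  rw [germ_eq_iff_exists]
  -- If the ultrafilter contained `nec x`, then `x` would have germ `⊤`; so it contains the
  -- complement.
  refine ⟨dm (nec x), ?_, ?_⟩
  · rw [basic_dm hc]
    intro h
    exact hx (germ_eq_iff_exists.2 ⟨_, h, by
      rw [inf_eq_left.2 (nec_le x)]; exact (inf_top_eq _).symm⟩)
  · rw [inf_bot_eq, inf_comm]; exact hc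

end Stalk

/-! ### Classification of the local algebras -/

section Classification

variable {L : Alg.{u}} [hL : Fact (IsRUNO1 L)]

/-- Algebras in which `⊥` is the only central element below any `x ≠ ⊤`. -/
def IsLocal (L : Alg.{u}) [Fact (IsRUNO1 L)] : Prop := ∀ x : L, x ≠ ⊤ → nec x = ⊥

/-- The two inequalities are `nec x = ⊥` and `nec (dm x) = ⊥`. -/
theorem IsLocal.pc_dm (hs : IsLocal L) {x : L} (h0 : x ≠ ⊥) (h1 : x ≠ ⊤) :
    pc (dm x) = pc x := by
  apply le_antisymm
  · exact le_pc_iff.2 (hs x h1)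
  · apply le_pc_iff.2
    have := hs (dm x) (fun h => h0 (dm_eq_top.1 h))
    rwa [nec, dm_dm'] at this

theorem pc_ne_top {x : L} (h0 : x ≠ ⊥) : pc x ≠ ⊤ := by
  intro h
  have := inf_pc x
  rw [h, inf_top_eq] at this
  exact h0 this

theorem pc_pc_ne_bot {x : L} (h0 : x ≠ ⊥) : pc (pc x) ≠ ⊥ :=
  fun h => h0 (le_bot_iff.1 ((le_pc_pc x).trans h.le))

theorem pc_pc_pc (x : L) : pc (pc (pc x)) = pc x :=
  le_antisymm (pc_anti (le_pc_pc x)) (le_pc_pc _)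

theorem IsLocal.dm_pc (hs : IsLocal L) {x : L} (h0 : x ≠ ⊥) (hd : pc x ≠ ⊥) :
    dm (pc x) = pc x := by
  have hv0 := pc_pc_ne_bot h0
  have hu1 := pc_ne_top h0
  have hv1 : pc (pc x) ≠ ⊤ := pc_ne_top hd
  have huv : dm (pc x) ⊓ pc (pc x) = ⊥ := by rw [← hs.pc_dm hd hu1]; exact inf_pc _
  have hvu : dm (pc (pc x)) ⊓ pc x = ⊥ := by
    have h := inf_pc (dm (pc (pc x)))
    rwa [hs.pc_dm hv0 hv1, pc_pc_pc] at h
  apply le_antisymm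
  · have h : dm (pc x) ≤ pc (pc (pc x)) := le_pc_iff.2 (by rw [inf_comm]; exact huv)
    rwa [pc_pc_pc] at h
  -- This is the De Morgan dual of `hvu`.
  · have h : pc (pc x) ⊔ dm (pc x) = ⊤ := by
      rw [← dm_eq_bot, dm_sup', dm_dm']; exact hvu
    calc pc x = pc x ⊓ (pc (pc x) ⊔ dm (pc x)) := by rw [h, inf_top_eq]
      _ = pc x ⊓ dm (pc x) := by rw [inf_sup_left, inf_pc, bot_sup_eq]
      _ ≤ dm (pc x) := inf_le_right

theorem IsLocal.pc_pc (hs : IsLocal L) {x : L} (h0 : x ≠ ⊥) (hd : pc x ≠ ⊥) : pc (pc x) = x := by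
  have h1 : x ≠ ⊤ := by rintro rfl; exact hd pc_top
  have hv : dm (pc (pc x)) = pc (pc x) := hs.dm_pc hd (pc_pc_ne_bot h0)
  refine le_antisymm ?_ (le_pc_pc x)
  have h : dm x ≤ pc (pc x) := by rw [← hs.pc_dm h0 h1]; exact le_pc_pc _
  have := dm_le_of_dm_le h
  rwa [hv] at this

theorem IsLocal.dm_eq_self (hs : IsLocal L) {x : L} (h0 : x ≠ ⊥) (hd : pc x ≠ ⊥) : dm x = x := by
  rw [← hs.pc_pc h0 hd]
  exact hs.dm_pc hd (pc_pc_ne_bot h0)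

theorem IsLocal.sup_pc (hs : IsLocal L) {x : L} (h0 : x ≠ ⊥) (hd : pc x ≠ ⊥) :
    x ⊔ pc x = ⊤ := by
  rw [← dm_eq_bot, dm_sup', hs.dm_eq_self h0 hd, hs.dm_pc h0 hd, inf_pc]

/-- For dense `x` and `y` regularity collapses to `x ≤ y`. So there is at most one dense element
besides `⊤`, and `dm` must fix it. -/
theorem IsLocal.le_of_dense (hs : IsLocal L) {x y : L} (h0 : x ≠ ⊥) (h1 : x ≠ ⊤) (hx : pc x = ⊥)
    (hy : pc y = ⊥) : x ≤ y := by
  have := inf_eq_left.1 (hL.out.regular x y)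
  rw [hs.pc_dm h0 h1, hx, hy, dm_bot'] at this
  have h2 : x ⊓ ⊤ ≤ y ⊔ ⊥ := this
  rwa [inf_top_eq, sup_bot_eq] at h2

theorem IsLocal.dm_eq_self_of_dense (hs : IsLocal L) {x : L} (h0 : x ≠ ⊥) (h1 : x ≠ ⊤)
    (hx : pc x = ⊥) : dm x = x := by
  have hd : pc (dm x) = ⊥ := by rw [hs.pc_dm h0 h1, hx]
  exact le_antisymm
    (hs.le_of_dense (fun h => h1 (dm_eq_bot.1 h)) (fun h => h0 (dm_eq_top.1 h)) hd hx)
    (hs.le_of_dense h0 h1 hx hd)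

theorem IsLocal.dm_eq_self' (hs : IsLocal L) {x : L} (h0 : x ≠ ⊥) (h1 : x ≠ ⊤) : dm x = x := by
  by_cases hx : pc x = ⊥
  · exact hs.dm_eq_self_of_dense h0 h1 hx
  · exact hs.dm_eq_self h0 hx

/-- The elements other than `⊥` and `⊤` form an antichain. -/
theorem IsLocal.eq_of_inf_ne_bot (hs : IsLocal L) {x y : L} (hx : x ≠ ⊤) (hy : y ≠ ⊤)
    (h : x ⊓ y ≠ ⊥) : x = y := by
  have hx0 : x ≠ ⊥ := by rintro rfl; exact h (bot_inf_eq _)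
  have hy0 : y ≠ ⊥ := by rintro rfl; exact h (inf_bot_eq _)
  have h1 : x ⊓ y ≠ ⊤ := fun h' => hx (top_le_iff.1 (h'.ge.trans inf_le_left))
  -- Since `dm` fixes `x`, `y` and `x ⊓ y`, De Morgan's law gives `x ⊔ y = x ⊓ y`.
  have h2 := hs.dm_eq_self' h h1
  rw [dm_inf', hs.dm_eq_self' hx0 hx, hs.dm_eq_self' hy0 hy] at h2
  exact le_antisymm ((le_sup_left.trans h2.le).trans inf_le_right)
    ((le_sup_right.trans h2.le).trans inf_le_left)

theorem IsLocal.eq_or_eq_pc (hs : IsLocal L) {a x : L} (ha0 : a ≠ ⊥) (ha : a ≠ ⊤)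
    (hx0 : x ≠ ⊥) (hx : x ≠ ⊤) : x = a ∨ x = pc a := by
  by_cases h : a ⊓ x = ⊥
  · right
    have hle : x ≤ pc a := le_pc_iff.2 h
    refine hs.eq_of_inf_ne_bot hx (pc_ne_top ha0) ?_
    rwa [inf_eq_left.2 hle]
  · exact .inl (hs.eq_of_inf_ne_bot ha hx h).symm

theorem isHom_chainAlg {t : Fin 3 → Fin 3 → Fin 3} {f : Fin 3 → L} (h0 : f 0 = ⊥) (h1 : f 1 = ⊤)
    (h2 : dm (f 2) = f 2) (ht : ∀ i j, f (t i j) = f i ⇨ f j) :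
    IsHom (A := chainAlg t) (B := L) f where
  map_sup := by
    change ∀ x y : Fin 3, f (![![0, 1, 2], ![1, 1, 1], ![2, 1, 2]] x y) = f x ⊔ f y
    intro x y
    fin_cases x <;> fin_cases y <;> simp [h0, h1]
  map_inf := by
    change ∀ x y : Fin 3, f (![![0, 0, 0], ![0, 1, 2], ![0, 2, 2]] x y) = f x ⊓ f y
    intro x y
    fin_cases x <;> fin_cases y <;> simp [h0, h1]
  map_himp := ht
  map_dm := by
    change ∀ x : Fin 3, f (![1, 0, 2] x) = dm (f x)
    intro x
    fin_cases x <;> simp [h0, h1, h2, dm_bot', dm_top']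
  map_bot := h0
  map_top := h1

theorem le_bot_himp_self (x : L) (hx : x ≤ ⊥ ⇨ ⊤) : x ≤ ⊥ ⇨ x := by
  have h := inf_himp_inf' x ⊥ ⊤
  rw [inf_eq_left.2 hx, inf_bot_eq, inf_top_eq] at h
  exact inf_eq_left.1 h.symm

theorem le_himp_top (x : L) : x ≤ x ⇨ ⊤ := by
  have h := inf_himp' x ⊤
  rw [inf_top_eq] at h
  exact inf_eq_left.1 h

/-- The unorthodox identity makes `⊥ ⇨ ⊤` a fixed point of `dm`, which swaps `⊥` and `⊤`. -/
theorem bot_himp_top_ne (hn : (⊥ : L) ≠ ⊤) :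
    (⊥ : L) ⇨ ⊤ ≠ ⊥ ∧ (⊥ : L) ⇨ ⊤ ≠ ⊤ := by
  have ha : dm ((⊥ : L) ⇨ ⊤) = ⊥ ⇨ ⊤ := hL.out.unorthodox
  constructor <;> intro h <;> rw [h] at ha
  · exact hn (ha.symm.trans dm_bot')
  · exact hn (dm_top'.symm.trans ha)

theorem injective_chain {a : L} (hn : (⊥ : L) ≠ ⊤) (h0 : a ≠ ⊥) (h1 : a ≠ ⊤) :
    Function.Injective ![⊥, ⊤, a] := by
  intro i j
  fin_cases i <;> fin_cases j <;> simp [hn, hn.symm, h0, h1, h0.symm, h1.symm]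

theorem injective_square {a b : L} (hn : (⊥ : L) ≠ ⊤) (h0 : a ≠ ⊥) (h1 : a ≠ ⊤) (h2 : b ≠ ⊥)
    (h3 : b ≠ ⊤) (h4 : a ≠ b) : Function.Injective ![⊥, ⊤, a, b] := by
  intro i j
  fin_cases i <;> fin_cases j <;>
    simp [hn, hn.symm, h0, h1, h0.symm, h1.symm, h2, h2.symm, h3, h3.symm, h4, h4.symm]

theorem IsLocal.exists_chain (hs : IsLocal L) (hn : (⊥ : L) ≠ ⊤)
    (hd : pc ((⊥ : L) ⇨ ⊤) = ⊥) :
    ∃ C ∈ ({A1, A2, A3, A4} : Set Alg.{0}), ∃ f : C → L, IsHom f ∧ Function.Bijective f := by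
  obtain ⟨ha0, ha1⟩ := bot_himp_top_ne hn
  have ha : dm ((⊥ : L) ⇨ ⊤) = ⊥ ⇨ ⊤ := hL.out.unorthodox
  obtain ⟨a, hdef⟩ : ∃ a : L, a = ⊥ ⇨ ⊤ := ⟨_, rfl⟩
  rw [← hdef] at ha0 ha1 hd ha
  have hall : ∀ x : L, x = ⊥ ∨ x = ⊤ ∨ x = a := fun x => by
    by_contra! h
    exact (hs.eq_or_eq_pc ha0 ha1 h.1 h.2.1).elim h.2.2 (fun h' => h.1 (h'.trans hd))
  have habove : ∀ x : L, a ≤ x → x = ⊤ ∨ x = a := fun x hx =>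
    (hall x).resolve_left (by rintro rfl; exact ha0 (le_bot_iff.1 hx))
  have hbij : Function.Bijective ![⊥, ⊤, a] := by
    refine ⟨injective_chain hn ha0 ha1, fun x => ?_⟩
    rcases hall x with rfl | rfl | rfl
    exacts [⟨0, rfl⟩, ⟨1, rfl⟩, ⟨2, rfl⟩]
  have hap : a ⇨ ⊥ = ⊥ := hd
  have key : ∀ t : Fin 3 → Fin 3 → Fin 3,
      (∀ i j, (![⊥, ⊤, a] : Fin 3 → L) (t i j) = ![⊥, ⊤, a] i ⇨ ![⊥, ⊤, a] j) →
      ∃ f : chainAlg t → L, IsHom f ∧ Function.Bijective f := fun t ht =>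
    ⟨![⊥, ⊤, a], isHom_chainAlg rfl rfl ha ht, hbij⟩
  -- The values `⊥ ⇨ a` and `a ⇨ ⊤` lie above `a`, so each is `⊤` or `a`; the four combinations are
  -- the four chains.
  rcases habove _ (le_bot_himp_self a hdef.le) with h1 | h1 <;>
    rcases habove _ (le_himp_top a) with h2 | h2
  · refine ⟨A1, by simp, key _ fun i j => ?_⟩
    fin_cases i <;> fin_cases j <;> simp [himp_self', top_himp', ← hdef, hap, h1, h2]
  · refine ⟨A2, by simp, key _ fun i j => ?_⟩
    fin_cases i <;> fin_cases j <;> simp [himp_self', top_himp', ← hdef, hap, h1, h2]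
  · refine ⟨A3, by simp, key _ fun i j => ?_⟩
    fin_cases i <;> fin_cases j <;> simp [himp_self', top_himp', ← hdef, hap, h1, h2]
  · refine ⟨A4, by simp, key _ fun i j => ?_⟩
    fin_cases i <;> fin_cases j <;> simp [himp_self', top_himp', ← hdef, hap, h1, h2]

theorem isHom_A5 {f : Fin 4 → L} (h0 : f 0 = ⊥) (h1 : f 1 = ⊤)
    (h2 : dm (f 2) = f 2) (h3 : dm (f 3) = f 3) (hinf : f 2 ⊓ f 3 = ⊥) (hsup : f 2 ⊔ f 3 = ⊤)
    (ht : ∀ i j : Fin 4, f (![![1, 2, 1, 2], ![0, 1, 2, 3], ![3, 2, 1, 0], ![2, 1, 2, 1]] i j) =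
      f i ⇨ f j) :
    IsHom (A := A5) (B := L) f where
  map_sup := by
    change ∀ x y : Fin 4,
      f (![![0, 1, 2, 3], ![1, 1, 1, 1], ![2, 1, 2, 1], ![3, 1, 1, 3]] x y) = f x ⊔ f y
    have hsup' := (sup_comm _ _).trans hsup
    intro x y
    fin_cases x <;> fin_cases y <;> simp [h0, h1, hsup, hsup']
  map_inf := by
    change ∀ x y : Fin 4,
      f (![![0, 0, 0, 0], ![0, 1, 2, 3], ![0, 2, 2, 0], ![0, 3, 0, 3]] x y) = f x ⊓ f y
    have hinf' := (inf_comm _ _).trans hinf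
    intro x y
    fin_cases x <;> fin_cases y <;> simp [h0, h1, hinf, hinf']
  map_himp := ht
  map_dm := by
    change ∀ x : Fin 4, f (![1, 0, 2, 3] x) = dm (f x)
    intro x
    fin_cases x <;> simp [h0, h1, h2, h3, dm_bot', dm_top']
  map_bot := h0
  map_top := h1

theorem IsLocal.exists_square (hs : IsLocal L) (hn : (⊥ : L) ≠ ⊤)
    (hd : pc ((⊥ : L) ⇨ ⊤) ≠ ⊥) :
    ∃ f : A5 → L, IsHom f ∧ Function.Bijective f := by
  obtain ⟨ha0, ha1⟩ := bot_himp_top_ne hn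
  have ha : dm ((⊥ : L) ⇨ ⊤) = ⊥ ⇨ ⊤ := hL.out.unorthodox
  obtain ⟨a, hdef⟩ : ∃ a : L, a = ⊥ ⇨ ⊤ := ⟨_, rfl⟩
  rw [← hdef] at ha0 ha1 hd ha
  obtain ⟨b, hb⟩ : ∃ b : L, b = pc a := ⟨_, rfl⟩
  have hinf : a ⊓ b = ⊥ := by rw [hb, inf_pc]
  have hsup : a ⊔ b = ⊤ := by rw [hb, hs.sup_pc ha0 hd]
  have hbdm : dm b = b := by rw [hb, hs.dm_pc ha0 hd]
  have hb1 : b ≠ ⊤ := hb ▸ pc_ne_top ha0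
  have hall : ∀ x : L, x = ⊥ ∨ x = ⊤ ∨ x = a ∨ x = b := fun x => by
    by_contra! h
    exact (hs.eq_or_eq_pc ha0 ha1 h.1 h.2.1).elim h.2.2.1 (hb ▸ h.2.2.2)
  rw [← hb] at hd
  have hab : a ≠ b := by
    intro h
    rw [← h, inf_idem] at hinf
    exact ha0 hinf
  have hinf' : b ⊓ a = ⊥ := by rw [inf_comm, hinf]
  -- As `a ⊔ b = ⊤`, the table of `⇨` can be checked below `a` and below `b` separately, where the
  -- arguments reduce to `⊥` and `a`, or `⊥` and `b`.
  have hext : ∀ x y : L, a ⊓ x = a ⊓ y → b ⊓ x = b ⊓ y → x = y := fun x y h h' => by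
    rw [← top_inf_eq x, ← top_inf_eq y, ← hsup, inf_sup_right, inf_sup_right, h, h']
  have hbt : b ⊓ (⊥ ⇨ b) = ⊥ := by
    have h := inf_himp_inf' b ⊥ ⊤
    rw [inf_bot_eq, inf_top_eq, ← hdef, hinf'] at h
    exact h.symm
  have hat : a ⊓ (⊥ ⇨ a) = a := inf_eq_left.2 (le_bot_himp_self a hdef.le)
  have hpa : a ⊓ (a ⇨ ⊥) = ⊥ := inf_pc a
  have hpb : b ⊓ (b ⇨ ⊥) = ⊥ := inf_pc b
  refine ⟨![⊥, ⊤, a, b], isHom_A5 rfl rfl ha hbdm hinf hsup fun i j => ?_,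
    injective_square hn ha0 ha1 hd hb1 hab, fun x => ?_⟩
  · apply hext
    · rw [inf_himp_inf' a]
      fin_cases i <;> fin_cases j <;> simp [himp_self', hinf, hat, hpa]
    · rw [inf_himp_inf' b]
      fin_cases i <;> fin_cases j <;> simp [himp_self', hinf', hbt, hpb]
  · rcases hall x with rfl | rfl | rfl | rfl
    exacts [⟨(0 : Fin 4), rfl⟩, ⟨(1 : Fin 4), rfl⟩, ⟨(2 : Fin 4), rfl⟩, ⟨(3 : Fin 4), rfl⟩]

theorem IsLocal.exists_isHom_bijective (hs : IsLocal L) (hn : (⊥ : L) ≠ ⊤) :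
    ∃ C ∈ ({A1, A2, A3, A4, A5} : Set Alg.{0}),
      ∃ f : C → L, IsHom f ∧ Function.Bijective f := by
  by_cases hd : pc ((⊥ : L) ⇨ ⊤) = ⊥
  · obtain ⟨C, hC, h⟩ := hs.exists_chain hn hd
    refine ⟨C, ?_, h⟩
    simp only [Set.mem_insert_iff, Set.mem_singleton_iff] at *
    tauto
  · exact ⟨A5, by simp, hs.exists_square hn hd⟩

end Classification

/-! ### Assembling the Boolean product -/

section BooleanProduct

variable {A : Alg.{u}} [hA : Fact (IsRUNO1 A)]

theorem exists_isHom_stalk (p : Point A) :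
    ∃ C ∈ ({A1, A2, A3, A4, A5} : Set Alg.{0}), ∃ f : A → C, IsHom f ∧ Function.Surjective f ∧
      ∀ x y, f x = f y ↔ germ p x = germ p y := by
  have hs : IsLocal (stalk p) := nec_eq_bot_of_ne_top
  obtain ⟨C, hC, g, hg, hb⟩ := hs.exists_isHom_bijective stalk_bot_ne_top
  let e : C.carrier ≃ (stalk p).carrier := Equiv.ofBijective g hb
  have he : IsHom e.symm := IsHom.symm e hg
  exact ⟨C, hC, fun x => e.symm (germ p x), he.comp isHom_germ,
    e.symm.surjective.comp germ_surjective, fun x y => e.symm.injective.eq_iff⟩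

theorem eq_of_forall_germ_eq {x y : A} (h : ∀ p : Point A, germ p x = germ p y) : x = y := by
  have hc := isCentral_nec (biimp x y)
  have h1 : nec (biimp x y) = ⊤ := by
    rw [← dm_eq_bot]
    by_contra hne
    -- At an ultrafilter containing the complement of `nec (biimp x y)` the two germs would differ.
    obtain ⟨p, hp⟩ := basic_nonempty hne hc.dm
    rw [basic_dm hc] at hp
    exact hp (germ_eq_iff.1 (h p))
  have h2 := nec_biimp_inf x y
  rwa [h1, top_inf_eq, top_inf_eq] at h2

/-- The range of a family of homomorphisms, as a subalgebra of the product. -/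
def rangeProd {X : Type u} {F : X → Alg.{v}} (f : ∀ x, A → F x) (hf : ∀ x, IsHom (f x)) :
    SubAlg (prod F) where
  carrier := Set.range fun (a : A) x => f x a
  sup_mem := by
    rintro _ ⟨a, rfl⟩ _ ⟨b, rfl⟩
    exact ⟨a ⊔ b, funext fun x => (hf x).map_sup a b⟩
  inf_mem := by
    rintro _ ⟨a, rfl⟩ _ ⟨b, rfl⟩
    exact ⟨a ⊓ b, funext fun x => (hf x).map_inf a b⟩
  himp_mem := by
    rintro _ ⟨a, rfl⟩ _ ⟨b, rfl⟩
    exact ⟨a ⇨ b, funext fun x => (hf x).map_himp a b⟩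
  dm_mem := by
    rintro _ ⟨a, rfl⟩
    exact ⟨dm a, funext fun x => (hf x).map_dm a⟩
  bot_mem := ⟨⊥, funext fun x => (hf x).map_bot⟩
  top_mem := ⟨⊤, funext fun x => (hf x).map_top⟩

theorem nonempty_iso_rangeProd {X : Type u} {F : X → Alg.{v}} (f : ∀ x, A → F x)
    (hf : ∀ x, IsHom (f x)) (hinj : ∀ a b, (∀ x, f x a = f x b) → a = b) :
    Nonempty (Iso A (rangeProd f hf).toAlg) :=
  ⟨{ Equiv.ofInjective (fun (a : A) x => f x a) (fun a b h => hinj a b (congrFun h)) with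
      map_sup := fun a b => Subtype.ext (funext fun x => (hf x).map_sup a b)
      map_inf := fun a b => Subtype.ext (funext fun x => (hf x).map_inf a b)
      map_himp := fun a b => Subtype.ext (funext fun x => (hf x).map_himp a b)
      map_dm := fun a => Subtype.ext (funext fun x => (hf x).map_dm a)
      map_bot := Subtype.ext (funext fun x => (hf x).map_bot)
      map_top := Subtype.ext (funext fun x => (hf x).map_top) }⟩

theorem exists_patch (x y : A) {b : A} (hb : IsCentral b) :
    ∃ z : A, (∀ p ∈ basic b, germ p z = germ p x) ∧ (∀ p ∉ basic b, germ p z = germ p y) := by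
  -- This element agrees with `x` below `b` and with `y` below the complement `dm b`.
  refine ⟨b ⊓ x ⊔ dm b ⊓ y, fun p hp => germ_eq_iff_exists.2 ⟨b, hp, ?_⟩,
    fun p hp => germ_eq_iff_exists.2 ⟨dm b, by rw [basic_dm hb]; exact hp, ?_⟩⟩
  · rw [inf_sup_left, ← inf_assoc, ← inf_assoc, inf_idem, show b ⊓ dm b = ⊥ from hb, bot_inf_eq,
      sup_bot_eq]
  · rw [inf_sup_left, ← inf_assoc, ← inf_assoc, inf_idem, inf_comm (dm b) b,
      show b ⊓ dm b = ⊥ from hb, bot_inf_eq, bot_sup_eq]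

theorem isBooleanProduct_rangeProd {F : Point A → Alg.{v}} (f : ∀ p, A → F p)
    (hf : ∀ p, IsHom (f p)) (hs : ∀ p, Function.Surjective (f p))
    (hg : ∀ p x y, f p x = f p y ↔ germ p x = germ p y) :
    IsBooleanProduct F (rangeProd f hf) where
  compact := inferInstance
  hausdorff := inferInstance
  totallyDisconnected := inferInstance
  subdirect p c := by
    obtain ⟨a, rfl⟩ := hs p c
    exact ⟨_, ⟨a, rfl⟩, rfl⟩
  equalizer_clopen := by
    rintro _ ⟨a, rfl⟩ _ ⟨b, rfl⟩
    have : {p : Point A | f p a = f p b} = basic (nec (biimp a b)) := by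
      ext p
      exact (hg p a b).trans germ_eq_iff
    exact this ▸ isClopen_basic _
  patchwork := by
    rintro _ ⟨a, rfl⟩ _ ⟨b, rfl⟩ N hN h h1 h2
    obtain ⟨c, hc, rfl⟩ := exists_eq_basic hN
    obtain ⟨z, hz1, hz2⟩ := exists_patch a b hc
    refine ⟨z, funext fun p => ?_⟩
    by_cases hp : p ∈ basic c
    · exact ((hg p _ _).2 (hz1 p hp)).trans (h1 p hp).symm
    · exact ((hg p _ _).2 (hz2 p hp)).trans (h2 p hp).symm

theorem nonempty_point [Nontrivial A.carrier] : Nonempty (Point A) := by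
  have h : (⊤ : A) ≠ ⊥ := top_ne_bot
  obtain ⟨p, -⟩ := basic_nonempty h (by rw [← dm_bot']; exact isCentral_bot.dm)
  exact ⟨p⟩

end BooleanProduct

end Runo

theorem corollary4p7 (A : Runo.Alg.{u}) (hA : A ∈ Runo.RUNO1) :
    ∃ (X : Type u) (_ : TopologicalSpace X) (F : X → Runo.Alg.{0})
      (S : Runo.SubAlg (Runo.prod F)),
      (∀ x, F x ∈ ({Runo.A1, Runo.A2, Runo.A3, Runo.A4, Runo.A5} : Set Runo.Alg.{0})) ∧
      Runo.IsBooleanProduct F S ∧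
      (Nontrivial A.carrier → Nonempty X) ∧
      Nonempty (Runo.Iso A S.toAlg) := by
  have : Fact (Runo.IsRUNO1 A) := ⟨hA⟩
  choose F hF f hf hs hg using Runo.exists_isHom_stalk (A := A)
  exact ⟨Runo.Point A, inferInstance, F, Runo.rangeProd f hf, hF,
    Runo.isBooleanProduct_rangeProd f hf hs hg, fun _ => Runo.nonempty_point,
    Runo.nonempty_iso_rangeProd f hf fun a b h =>
      Runo.eq_of_forall_germ_eq fun p => (hg p a b).1 (h p)⟩
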